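/- Let $\Gamma^+$ be a compact subset of the open upper half-plane $\mathbb C^+$, let $\lambda$ be a finite positive Borel measure on $\Gamma^+$, and let $\sigma:\Gamma^+\to[0,\infty)$ be continuous. For a finite positive Borel measure $\mu$ on $\Gamma^+$ let $$G\mu(z)=\frac1\pi\int\log\left|\frac{z-\overline w}{z-w}\right|d\mu(w)\in[0,+\infty]$$ be its Green potential (the integrand is $+\infty$ at $w=z$). Suppose that $\Gamma^+$ contains a simple closed (Jordan) curve that is the boundary $\partial\Omega$ of a bounded open set $\Omega$, that $\sigma=0$ on $\partial\Omega$, and that $\varphi$ is a real-valued continuous function on $\Gamma^+\cup\Omega$ that is harmonic on $\Omega$. Let $\mu^*$ be a finite positive Borel measure on $\Gamma^+$ that solves $G\mu^*+\sigma u^*=\varphi$ on $\Gamma^+$ in at least one of the following two senses. (i) (Solution at every point.) There is a measurable function $u^*\ge 0$ with finite values such that $\sigma\mu^*=\sigma u^*\lambda$ and $G\mu^*(z)+\sigma(z)u^*(z)=\varphi(z)$ for every $z\in\Gamma^+$. (ii) (Variational, or weak, solution.) $\mu^*$ minimizes, among all finite positive Borel measures $\mu$ on $\Gamma^+$, the energy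 $$J_\sigma(\mu)=\int G\mu\,d\mu-2\int\varphi\,d\mu+\int\sigma u^2\,d\lambda\quad\text{if }\sigma\mu=\sigma u\lambda\text{ for some measurable } u\ge0,$$ and $J_\sigma(\mu)=+\infty$ if there is no such $u$. Then $\operatorname{supp}\mu^*\cap\Omega=\emptyset$. -/

import Mathlib

open MeasureTheory Set
open scoped ENNReal NNReal

noncomputable section

namespace SolitonGas

/-- A Jordan curve in the plane: an injective continuous image of the unit circle. -/
def IsSimpleClosedCurve (C : Set ℂ) : Prop :=
  ∃ γ : Circle → ℂ, Continuous γ ∧ Function.Injective γ ∧ range γ = C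

/-- The Green kernel of the upper half-plane, `(1/π) log |(z - w̄) / (z - w)|`, with the value
`+∞` on the diagonal. It is nonnegative for `z, w` in the upper half-plane. -/
def greenKernel (z w : ℂ) : ℝ≥0∞ :=
  if z = w then ⊤
  else ENNReal.ofReal (1 / Real.pi * Real.log ‖(z - (starRingEnd ℂ) w) / (z - w)‖)

/-- The Green potential `Gμ` of a positive measure, with values in `[0, +∞]`. -/
def greenPotential (μ : Measure ℂ) (z : ℂ) : ℝ≥0∞ := ∫⁻ w, greenKernel z w ∂μ

/-- A finite positive Borel measure carried by `Γ`. -/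
def IsMeasureOn (Γ : Set ℂ) (μ : Measure ℂ) : Prop := IsFiniteMeasure μ ∧ μ Γᶜ = 0

/-- `u ≥ 0` is a density of `μ` in the sense that `σ μ = σ u ρ`, for the reference measure `ρ`. -/
def IsSigmaDensity (ρ : Measure ℂ) (σ : ℂ → ℝ≥0) (μ : Measure ℂ) (u : ℂ → ℝ≥0) : Prop :=
  Measurable u ∧
    μ.withDensity (fun z => (σ z : ℝ≥0∞)) = ρ.withDensity (fun z => (σ z : ℝ≥0∞) * (u z : ℝ≥0∞))

/-- `μ`, with density `u`, solves `Gμ + σ u = φ` at every point of `Γ`. -/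
def IsSolution (Γ : Set ℂ) (ρ : Measure ℂ) (σ : ℂ → ℝ≥0) (φ : ℂ → ℝ)
    (μ : Measure ℂ) (u : ℂ → ℝ≥0) : Prop :=
  IsMeasureOn Γ μ ∧ IsSigmaDensity ρ σ μ u ∧
    ∀ z ∈ Γ, (greenPotential μ z : EReal) + ((σ z * u z : ℝ≥0) : ℝ) = (φ z : EReal)

/-- `∫ σ u² dρ` where `σ μ = σ u ρ`, and `+∞` if there is no such `u`. The integral does not depend
on the choice of `u` (see `sigmaTerm_eq`), so the infimum is over at most one value. -/
def sigmaTerm (ρ : Measure ℂ) (σ : ℂ → ℝ≥0) (μ : Measure ℂ) : ℝ≥0∞ :=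
  ⨅ (u : ℂ → ℝ≥0) (_ : IsSigmaDensity ρ σ μ u), ∫⁻ z, (σ z : ℝ≥0∞) * (u z : ℝ≥0∞) ^ 2 ∂ρ

theorem sigmaTerm_eq {ρ : Measure ℂ} [IsFiniteMeasure ρ] {σ : ℂ → ℝ≥0} (hσ : AEMeasurable σ ρ)
    {μ : Measure ℂ} {u : ℂ → ℝ≥0} (hu : IsSigmaDensity ρ σ μ u) :
    sigmaTerm ρ σ μ = ∫⁻ z, (σ z : ℝ≥0∞) * (u z : ℝ≥0∞) ^ 2 ∂ρ := by
  refine le_antisymm (iInf₂_le u hu) (le_iInf₂ fun v hv => le_of_eq ?_)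
  have hm : ∀ w : ℂ → ℝ≥0, Measurable w →
      AEMeasurable (fun z => (σ z : ℝ≥0∞) * (w z : ℝ≥0∞)) ρ := fun w hw =>
    hσ.coe_nnreal_ennreal.mul hw.coe_nnreal_ennreal.aemeasurable
  have h := hu.2.symm.trans hv.2
  rw [withDensity_eq_iff_of_sigmaFinite (hm u hu.1) (hm v hv.1)] at h
  refine lintegral_congr_ae ?_
  filter_upwards [h] with z hz
  by_cases h0 : σ z = 0
  · simp [h0]
  · have hz' : σ z * u z = σ z * v z := by exact_mod_cast hz
    rw [mul_left_cancel₀ h0 hz']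

/-- The energy `J_σ(μ) = ∫ Gμ dμ - 2 ∫ φ dμ + ∫ σ u² dρ` where `σ μ = σ u ρ`, and `+∞` if `σ μ` has
no such density. -/
def energy (ρ : Measure ℂ) (σ : ℂ → ℝ≥0) (φ : ℂ → ℝ) (μ : Measure ℂ) : EReal :=
  ((∫⁻ z, greenPotential μ z ∂μ : ℝ≥0∞) : EReal) - ((2 * ∫ z, φ z ∂μ : ℝ) : EReal)
    + (sigmaTerm ρ σ μ : EReal)

/-- `μ` minimizes `J_σ` over the finite positive Borel measures carried by `Γ`. -/
def IsEnergyMinimizer (Γ : Set ℂ) (ρ : Measure ℂ) (σ : ℂ → ℝ≥0) (φ : ℂ → ℝ)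
    (μ : Measure ℂ) : Prop :=
  IsMeasureOn Γ μ ∧ ∀ ν : Measure ℂ, IsMeasureOn Γ ν → energy ρ σ φ μ ≤ energy ρ σ φ ν

end SolitonGas

end

/-! The measure vanishes on Ω because Gμ is squeezed against the harmonic function φ there, while Gμ
violates the mean value property near any mass it carries.

Lower bound: Gμ ≥ φ on Ω. The unit mass at z ∈ Ω is swept to a measure ν on ∂Ω with ∫ s dν ≤ s(z)
for superharmonic s (`exists_swept_measure`). Applied to -φ and, through truncations, to the Green
kernel, this gives φ(z) ≤ ∫ φ dν ≤ ∫ Gμ dν ≤ Gμ(z) (`ofReal_le_greenPotential`). The middle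
inequality is Gμ = φ on ∂Ω for a pointwise solution. For a minimizer it is the first-order condition
for adding tν, which costs no σ-term since σ = 0 on ∂Ω (`IsEnergyMinimizer.ofReal_integral_le`).
Using only integrals against ν avoids any regularity of ∂Ω or continuity of Gμ.

Upper bound: Gμ ≤ φ⁺ μ-a.e. on Ω. This is σu ≥ 0 for a pointwise solution. For a minimizer, removing
mass from Ω gives the integrated inequality (`IsEnergyMinimizer.setLIntegral_le`), and the lower
bound turns it into an a.e. equality.

At a point x where both bounds hold, the circle averages of Gμ around x cannot drop below Gμ(x).
Mass inside the circle would make them drop strictly, so μ vanishes near x (`measure_ball_eq_zero`).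
-/

noncomputable section

namespace SolitonGas

open Metric Filter Topology
open scoped Pointwise CompactlySupported

/-! ### Superharmonic functions and the minimum principle -/

/-- `s` is continuous on the closure of `Ω` and satisfies the super-mean-value inequality on every
closed disk contained in `Ω`. -/
structure IsSuperharmonicCl (s : ℂ → ℝ) (Ω : Set ℂ) : Prop where
  continuousOn : ContinuousOn s (closure Ω)
  circleAverage_le : ∀ x r, 0 < r → closedBall x r ⊆ Ω → Real.circleAverage s x r ≤ s x

theorem circleIntegrable_of_continuousOn_closure {s : ℂ → ℝ} {Ω : Set ℂ}
    (hs : ContinuousOn s (closure Ω)) {x : ℂ} {r : ℝ} (hr : 0 < r) (h : closedBall x r ⊆ Ω) :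
    CircleIntegrable s x r :=
  (hs.mono ((sphere_subset_closedBall.trans h).trans subset_closure)).circleIntegrable hr.le

theorem isSuperharmonicCl_const (c : ℝ) (Ω : Set ℂ) : IsSuperharmonicCl (fun _ => c) Ω :=
  ⟨continuousOn_const, fun x r _ _ => (Real.circleAverage_const c x r).le⟩

theorem IsSuperharmonicCl.add {s t : ℂ → ℝ} {Ω : Set ℂ} (hs : IsSuperharmonicCl s Ω)
    (ht : IsSuperharmonicCl t Ω) : IsSuperharmonicCl (s + t) Ω := by
  refine ⟨hs.1.add ht.1, fun x r hr h => ?_⟩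
  rw [Real.circleAverage_add (circleIntegrable_of_continuousOn_closure hs.1 hr h)
    (circleIntegrable_of_continuousOn_closure ht.1 hr h)]
  exact add_le_add (hs.2 x r hr h) (ht.2 x r hr h)

theorem IsSuperharmonicCl.smul {s : ℂ → ℝ} {Ω : Set ℂ} (hs : IsSuperharmonicCl s Ω) {c : ℝ}
    (hc : 0 ≤ c) : IsSuperharmonicCl (c • s) Ω := by
  refine ⟨hs.1.const_smul c, fun x r hr h => ?_⟩
  rw [Real.circleAverage_smul]
  exact mul_le_mul_of_nonneg_left (hs.2 x r hr h) hc

theorem _root_.InnerProductSpace.HarmonicOnNhd.isSuperharmonicCl {f : ℂ → ℝ} {Ω : Set ℂ}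
    (hf : InnerProductSpace.HarmonicOnNhd f Ω) (hc : ContinuousOn f (closure Ω)) :
    IsSuperharmonicCl f Ω :=
  ⟨hc, fun x r hr h => (InnerProductSpace.HarmonicOnNhd.circleAverage_eq
    (hf.mono (by rwa [abs_of_pos hr]))).le⟩

theorem circleAverage_norm_sq (x : ℂ) (r : ℝ) :
    Real.circleAverage (fun z => ‖z‖ ^ 2) x r = ‖x‖ ^ 2 + r ^ 2 := by
  -- Expanding |z - x|² = r² shows that ‖z‖² agrees on the circle with a function harmonic in z.
  have h : ∀ z ∈ sphere x |r|, ‖z‖ ^ 2 =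
      (((r ^ 2 - ‖x‖ ^ 2 : ℝ) : ℂ) + 2 * (starRingEnd ℂ x * z)).re := by
    intro z hz
    have h1 : ‖z - x‖ ^ 2 = r ^ 2 := by
      rw [mem_sphere_iff_norm.1 hz, sq_abs]
    rw [Complex.sq_norm, Complex.normSq_apply] at h1 ⊢
    rw [Complex.sq_norm, Complex.normSq_apply]
    simp only [Complex.sub_re, Complex.sub_im, Complex.add_re, Complex.ofReal_re, Complex.mul_re,
      Complex.re_ofNat, Complex.im_ofNat, Complex.conj_re, Complex.conj_im] at h1 ⊢
    linarith
  rw [Real.circleAverage_congr_sphere h, InnerProductSpace.HarmonicOnNhd.circleAverage_eq]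
  · rw [Complex.sq_norm, Complex.normSq_apply]
    simp only [Complex.add_re, Complex.ofReal_re, Complex.mul_re,
      Complex.re_ofNat, Complex.im_ofNat, Complex.conj_re, Complex.conj_im]
    ring
  · intro z _
    exact AnalyticAt.harmonicAt_re (by fun_prop)

/-- The minimum principle. -/
theorem IsSuperharmonicCl.le_of_le_frontier {s : ℂ → ℝ} {Ω : Set ℂ} (hΩ : IsOpen Ω)
    (hΩb : Bornology.IsBounded Ω) (hs : IsSuperharmonicCl s Ω) {c : ℝ}
    (h : ∀ x ∈ frontier Ω, c ≤ s x) {z : ℂ} (hz : z ∈ Ω) : c ≤ s z := by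
  by_contra! hlt
  have hK : IsCompact (closure Ω) := hΩb.isCompact_closure
  obtain ⟨R, hR0, hR⟩ := hΩb.closure.exists_pos_norm_lt
  -- Subtracting ε‖w‖² makes the mean value inequality strict, which excludes an interior minimum; ε
  -- is small enough that no boundary value falls below `s z`.
  obtain ⟨ε, hε, hεR⟩ : ∃ ε : ℝ, 0 < ε ∧ ε * R ^ 2 < c - s z :=
    ⟨(c - s z) / (2 * R ^ 2), by have := sub_pos.2 hlt; positivity, by field_simp; linarith⟩
  have hsq : ContinuousOn (fun w : ℂ => (-ε) * ‖w‖ ^ 2) (closure Ω) := by fun_prop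
  obtain ⟨x, hx, hmin⟩ := hK.exists_isMinOn ⟨z, subset_closure hz⟩ (hs.1.add hsq)
  have hxz := hmin (subset_closure hz)
  simp only [mem_ofPred_eq, Pi.add_apply] at hxz
  have hz0 : 0 ≤ ε * ‖z‖ ^ 2 := by positivity
  have hxR : ε * ‖x‖ ^ 2 ≤ ε * R ^ 2 := by
    have := (hR x hx).le
    gcongr
  by_cases hxΩ : x ∈ Ω
  · obtain ⟨r, hr, hrΩ⟩ := nhds_basis_closedBall.mem_iff.1 (hΩ.mem_nhds hxΩ)
    have h1 := hs.2 x r hr hrΩ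
    have hi := circleIntegrable_of_continuousOn_closure hs.1 hr hrΩ
    have hi2 := circleIntegrable_of_continuousOn_closure hsq hr hrΩ
    have h2 : Real.circleAverage (fun w : ℂ => (-ε) * ‖w‖ ^ 2) x r
        = (-ε) * (‖x‖ ^ 2 + r ^ 2) := by
      rw [← circleAverage_norm_sq, ← smul_eq_mul, ← Real.circleAverage_smul]
      rfl
    have h3 : Real.circleAverage (fun _ => s x + (-ε) * ‖x‖ ^ 2) x r ≤
        Real.circleAverage (s + fun w : ℂ => (-ε) * ‖w‖ ^ 2) x r := by
      refine Real.circleAverage_mono (circleIntegrable_const _ _ _) (hi.add hi2) fun w hw => ?_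
      rw [abs_of_pos hr] at hw
      exact hmin (subset_closure (hrΩ (sphere_subset_closedBall hw)))
    rw [Real.circleAverage_const, Real.circleAverage_add hi hi2, h2] at h3
    have : 0 < ε * r ^ 2 := by positivity
    linarith
  · have := h x ⟨hx, by rwa [hΩ.interior_eq]⟩
    linarith

/-! ### Sweeping a point mass onto the boundary -/

/-- The values at `z` of the superharmonic majorants of `f : frontier Ω → ℝ`. -/
def majorantValues (Ω : Set ℂ) (z : ℂ) (f : frontier Ω → ℝ) : Set ℝ :=
  {t | ∃ s, IsSuperharmonicCl s Ω ∧ s z = t ∧ ∀ x : frontier Ω, f x ≤ s x}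

theorem majorantValues_smul (Ω : Set ℂ) (z : ℂ) (f : frontier Ω → ℝ) {c : ℝ} (hc : 0 < c) :
    majorantValues Ω z (c • f) = c • majorantValues Ω z f := by
  have key : ∀ (c : ℝ), 0 < c → ∀ f, c • majorantValues Ω z f ⊆ majorantValues Ω z (c • f) := by
    rintro c hc f _ ⟨_, ⟨s, hs, rfl, hf⟩, rfl⟩
    exact ⟨c • s, hs.smul hc.le, rfl, fun x => mul_le_mul_of_nonneg_left (hf x) hc.le⟩
  refine Subset.antisymm ?_ (key c hc f)
  have := key c⁻¹ (inv_pos.2 hc) (c • f)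
  rw [inv_smul_smul₀ hc.ne'] at this
  exact (Set.subset_smul_set_iff₀ hc.ne').2 this

theorem majorantValues_add (Ω : Set ℂ) (z : ℂ) (f g : frontier Ω → ℝ) :
    majorantValues Ω z f + majorantValues Ω z g ⊆ majorantValues Ω z (f + g) := by
  rintro _ ⟨_, ⟨s, hs, rfl, hf⟩, _, ⟨t, ht, rfl, hg⟩, rfl⟩
  exact ⟨s + t, hs.add ht, rfl, fun x => add_le_add (hf x) (hg x)⟩

theorem majorantValues_nonempty {Ω : Set ℂ} {z : ℂ} {f : frontier Ω → ℝ}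
    (hf : BddAbove (range f)) : (majorantValues Ω z f).Nonempty := by
  obtain ⟨c, hc⟩ := hf
  exact ⟨c, _, isSuperharmonicCl_const c Ω, rfl, fun x => hc (mem_range_self x)⟩

theorem le_of_mem_majorantValues {Ω : Set ℂ} (hΩ : IsOpen Ω) (hΩb : Bornology.IsBounded Ω)
    {z : ℂ} (hz : z ∈ Ω) {f : frontier Ω → ℝ} {c : ℝ} (hf : ∀ x, c ≤ f x) {t : ℝ}
    (ht : t ∈ majorantValues Ω z f) : c ≤ t := by
  obtain ⟨s, hs, rfl, h⟩ := ht
  exact hs.le_of_le_frontier hΩ hΩb (fun x hx => (hf ⟨x, hx⟩).trans (h ⟨x, hx⟩)) hz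

theorem bddBelow_majorantValues {Ω : Set ℂ} (hΩ : IsOpen Ω) (hΩb : Bornology.IsBounded Ω)
    {z : ℂ} (hz : z ∈ Ω) {f : frontier Ω → ℝ} (hf : BddBelow (range f)) :
    BddBelow (majorantValues Ω z f) := by
  obtain ⟨c, hc⟩ := hf
  exact ⟨c, fun t ht => le_of_mem_majorantValues hΩ hΩb hz (fun x => hc (mem_range_self x)) ht⟩

/-- The unit mass at a point of a bounded open set can be swept onto the boundary: there is a
finite measure on the boundary whose integrals of superharmonic functions do not exceed the values
at the point. -/
theorem exists_swept_measure {Ω : Set ℂ} (hΩ : IsOpen Ω) (hΩb : Bornology.IsBounded Ω)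
    {z : ℂ} (hz : z ∈ Ω) : ∃ ν : Measure ℂ, IsMeasureOn (frontier Ω) ν ∧
      ∀ s, IsSuperharmonicCl s Ω → ∫ x, s x ∂ν ≤ s z := by
  have hK : IsCompact (frontier Ω) :=
    hΩb.isCompact_closure.of_isClosed_subset isClosed_frontier frontier_subset_closure
  have : CompactSpace (frontier Ω) := isCompact_iff_compactSpace.1 hK
  have hbdd (f : C_c(frontier Ω, ℝ)) :
      BddAbove (range f) ∧ BddBelow (range f) :=
    ⟨(isCompact_range f.continuous).bddAbove, (isCompact_range f.continuous).bddBelow⟩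
  -- Hahn–Banach from the zero subspace: the infimum of the superharmonic majorants at z is
  -- sublinear in the boundary data, and the minimum principle makes it finite and nonnegative at 0.
  obtain ⟨g, -, hg⟩ := exists_extension_of_le_sublinear (⊥ : C_c(frontier Ω, ℝ) →ₗ.[ℝ] ℝ)
    (fun f => sInf (majorantValues Ω z f))
    (fun c hc f => by
      rw [CompactlySupportedContinuousMap.coe_smul, majorantValues_smul Ω z f hc,
        Real.sInf_smul_of_nonneg hc.le, smul_eq_mul])
    (fun f g => by
      rw [← csInf_add (majorantValues_nonempty (hbdd f).1)
        (bddBelow_majorantValues hΩ hΩb hz (hbdd f).2) (majorantValues_nonempty (hbdd g).1)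
        (bddBelow_majorantValues hΩ hΩb hz (hbdd g).2)]
      refine csInf_le_csInf ?_ ?_ ?_
      · exact bddBelow_majorantValues hΩ hΩb hz (hbdd (f + g)).2
      · exact (majorantValues_nonempty (hbdd f).1).add (majorantValues_nonempty (hbdd g).1)
      · exact majorantValues_add Ω z f g)
    (fun x => by
      have hx : x = 0 := Subsingleton.elim (α := (⊥ : Submodule ℝ C_c(frontier Ω, ℝ))) x 0
      subst hx
      rw [LinearPMap.map_zero]
      exact le_csInf (majorantValues_nonempty (hbdd 0).1) fun t ht =>
        le_of_mem_majorantValues hΩ hΩb hz (c := 0) (fun x => le_rfl) ht)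
  have hle {f : C_c(frontier Ω, ℝ)} {s : ℂ → ℝ} (hs : IsSuperharmonicCl s Ω)
      (hf : ∀ x : frontier Ω, f x ≤ s x) : g f ≤ s z :=
    (hg f).trans (csInf_le (bddBelow_majorantValues hΩ hΩb hz (hbdd f).2) ⟨s, hs, rfl, hf⟩)
  -- Positivity: the constant 0 majorizes `-f` when `f ≥ 0`.
  let Λ : C_c(frontier Ω, ℝ) →ₚ[ℝ] ℝ := PositiveLinearMap.mk₀ g fun f hf => by
    have := hle (f := -f) (isSuperharmonicCl_const 0 Ω) fun x => neg_nonpos.2 (hf x)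
    rw [map_neg] at this
    linarith
  refine ⟨(RealRMK.rieszMeasure Λ).map Subtype.val, ⟨?_, ?_⟩, fun s hs => ?_⟩
  · have : IsFiniteMeasure (RealRMK.rieszMeasure Λ) := inferInstance
    infer_instance
  · rw [Measure.map_apply measurable_subtype_coe isClosed_frontier.measurableSet.compl]
    convert measure_empty (μ := RealRMK.rieszMeasure Λ)
    ext x
    simp
  · rw [(MeasurableEmbedding.subtype_coe isClosed_frontier.measurableSet).integral_map]
    let f : C_c(frontier Ω, ℝ) := CompactlySupportedContinuousMap.continuousMapEquiv
      ⟨fun x => s x, (hs.1.mono frontier_subset_closure).domRestrict⟩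
    have := RealRMK.integral_rieszMeasure Λ f
    exact this.le.trans (hle hs fun x => le_rfl)

/-! ### The truncated Green kernel and circle averages -/

/-- The Green kernel of the upper half-plane with its singularity truncated at distance `δ`. -/
def truncatedGreen (δ : ℝ) (z w : ℂ) : ℝ :=
  1 / Real.pi * (Real.log ‖z - (starRingEnd ℂ) w‖ - Real.log (max δ ‖z - w‖))

theorem sub_conj_ne_zero {z w : ℂ} (hz : 0 < z.im) (hw : 0 < w.im) :
    z - (starRingEnd ℂ) w ≠ 0 := by
  intro h
  have := congrArg Complex.im h
  simp at this
  linarith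

theorem im_add_im_le_norm_sub_conj (z w : ℂ) : z.im + w.im ≤ ‖z - (starRingEnd ℂ) w‖ := by
  have := (le_abs_self _).trans (Complex.abs_im_le_norm (z - (starRingEnd ℂ) w))
  simpa using this

theorem norm_sub_le_norm_sub_conj {z w : ℂ} (hz : 0 < z.im) (hw : 0 < w.im) :
    ‖z - w‖ ≤ ‖z - (starRingEnd ℂ) w‖ := by
  rw [← sq_le_sq₀ (norm_nonneg _) (norm_nonneg _), Complex.sq_norm, Complex.sq_norm,
    Complex.normSq_apply, Complex.normSq_apply]
  simp only [Complex.sub_re, Complex.sub_im, Complex.conj_re, Complex.conj_im]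
  nlinarith [mul_pos hz hw]

theorem greenKernel_self (z : ℂ) : greenKernel z z = ⊤ := if_pos rfl

theorem greenKernel_of_ne {z w : ℂ} (hz : 0 < z.im) (hw : 0 < w.im) (h : z ≠ w) :
    greenKernel z w = ENNReal.ofReal (truncatedGreen 0 z w) := by
  rw [greenKernel, if_neg h, truncatedGreen, norm_div, Real.log_div, max_eq_right (norm_nonneg _)]
  · exact norm_ne_zero_iff.2 (sub_conj_ne_zero hz hw)
  · exact norm_ne_zero_iff.2 (sub_ne_zero.2 h)

theorem greenKernel_comm (z w : ℂ) : greenKernel z w = greenKernel w z := by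
  have h1 : ‖z - (starRingEnd ℂ) w‖ = ‖w - (starRingEnd ℂ) z‖ := by
    rw [← Complex.norm_conj, map_sub, Complex.conj_conj, norm_sub_rev]
  unfold greenKernel
  simp only [norm_div, h1, norm_sub_rev z w, eq_comm (a := z)]

theorem measurable_greenKernel : Measurable (Function.uncurry greenKernel) := by
  unfold greenKernel Function.uncurry
  refine Measurable.ite (measurableSet_eq_fun measurable_fst measurable_snd) measurable_const ?_
  have : Measurable (starRingEnd ℂ) := Complex.continuous_conj.measurable
  fun_prop

theorem max_pos_of_ne {z w : ℂ} (δ : ℝ) (h : z ≠ w) : 0 < max δ ‖z - w‖ :=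
  lt_max_of_lt_right (norm_pos_iff.2 (sub_ne_zero.2 h))

theorem truncatedGreen_nonneg {δ : ℝ} {z w : ℂ} (hz : 0 < z.im) (hw : 0 < w.im)
    (hδ : δ ≤ z.im + w.im) (h : 0 < max δ ‖z - w‖) : 0 ≤ truncatedGreen δ z w := by
  have : Real.log (max δ ‖z - w‖) ≤ Real.log ‖z - (starRingEnd ℂ) w‖ :=
    Real.log_le_log h (max_le (hδ.trans (im_add_im_le_norm_sub_conj z w))
      (norm_sub_le_norm_sub_conj hz hw))
  exact mul_nonneg (by positivity) (sub_nonneg.2 this)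

theorem truncatedGreen_anti {δ δ' : ℝ} {z w : ℂ} (h : δ ≤ δ') (h0 : 0 < max δ ‖z - w‖) :
    truncatedGreen δ' z w ≤ truncatedGreen δ z w := by
  unfold truncatedGreen
  gcongr

theorem ofReal_truncatedGreen_le {δ : ℝ} {z w : ℂ} (hz : 0 < z.im) (hw : 0 < w.im) (hδ : 0 ≤ δ) :
    ENNReal.ofReal (truncatedGreen δ z w) ≤ greenKernel z w := by
  rcases eq_or_ne z w with rfl | h
  · simp [greenKernel_self]
  · rw [greenKernel_of_ne hz hw h]
    exact ENNReal.ofReal_le_ofReal (truncatedGreen_anti hδ (max_pos_of_ne 0 h))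

/-- Prepares Fatou's lemma: the Green kernel is singular at its pole, so the sweeping inequality
reaches it only through its continuous truncations. -/
theorem greenKernel_le_liminf {z w : ℂ} (hz : 0 < z.im) (hw : 0 < w.im) {δ : ℕ → ℝ}
    (hδ : Tendsto δ atTop (𝓝 0)) (hδ0 : ∀ n, 0 < δ n) :
    greenKernel z w ≤ liminf (fun n => ENNReal.ofReal (truncatedGreen (δ n) z w)) atTop := by
  rcases eq_or_ne z w with rfl | h
  · rw [greenKernel_self, top_le_iff]
    refine Tendsto.liminf_eq ?_
    refine ENNReal.tendsto_ofReal_atTop.comp ?_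
    unfold truncatedGreen
    refine Tendsto.const_mul_atTop (by positivity) ?_
    refine tendsto_atTop_add_const_left _ _ (tendsto_neg_atBot_atTop.comp ?_)
    have : (fun n => Real.log (max (δ n) ‖z - z‖)) = fun n => Real.log (δ n) := by
      ext n
      rw [sub_self, norm_zero, max_eq_left (hδ0 n).le]
    rw [this]
    exact Real.tendsto_log_nhdsGT_zero.comp
      (tendsto_nhdsWithin_iff.2 ⟨hδ, Eventually.of_forall hδ0⟩)
  · rw [greenKernel_of_ne hz hw h]
    refine (Tendsto.liminf_eq ?_).ge
    refine ENNReal.tendsto_ofReal ?_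
    unfold truncatedGreen
    refine ((tendsto_const_nhds.sub ((hδ.max tendsto_const_nhds).log ?_)).const_mul _)
    exact (max_pos_of_ne 0 h).ne'

theorem continuousOn_truncatedGreen {δ : ℝ} (hδ : 0 < δ) {w : ℂ} (hw : 0 < w.im) :
    ContinuousOn (fun z => truncatedGreen δ z w) {z | 0 < z.im} := by
  unfold truncatedGreen
  refine continuousOn_const.mul (ContinuousOn.sub ?_ ?_)
  · exact ContinuousOn.log (by fun_prop) fun z hz => norm_ne_zero_iff.2 (sub_conj_ne_zero hz hw)
  · exact ContinuousOn.log (by fun_prop) fun z hz => (lt_max_of_lt_left hδ).ne'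

theorem circleAverage_log_norm_sub_conj {x w : ℂ} {r : ℝ} (hr : 0 < r)
    (h : closedBall x r ⊆ {z | 0 < z.im}) (hw : 0 < w.im) :
    Real.circleAverage (fun z => Real.log ‖z - (starRingEnd ℂ) w‖) x r =
      Real.log ‖x - (starRingEnd ℂ) w‖ := by
  refine InnerProductSpace.HarmonicOnNhd.circleAverage_eq (f := fun z : ℂ =>
    Real.log ‖z - (starRingEnd ℂ) w‖) fun z hz => ?_
  rw [abs_of_pos hr] at hz
  exact AnalyticAt.harmonicAt_log_norm (by fun_prop) (sub_conj_ne_zero (h hz) hw)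

theorem circleAverage_log_norm_sub (x w : ℂ) {r : ℝ} (hr : 0 < r) :
    Real.circleAverage (fun z => Real.log ‖z - w‖) x r = Real.log (max r ‖x - w‖) := by
  rw [circleAverage_log_norm_sub_const_eq_log_radius_add_posLog hr.ne', Real.posLog_def]
  simp only [Pi.sup_apply, Pi.zero_apply]
  rcases le_total ‖x - w‖ r with h | h
  · rw [max_eq_left h, max_eq_left, add_zero]
    refine Real.log_nonpos (by positivity) ?_
    rw [inv_mul_le_iff₀ hr]; linarith
  · have hp : 0 < ‖x - w‖ := hr.trans_le h
    rw [max_eq_right h, max_eq_right, Real.log_mul (by positivity) hp.ne', Real.log_inv]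
    · ring
    · refine Real.log_nonneg ?_
      rw [le_inv_mul_iff₀ hr]; linarith

theorem circleIntegrable_truncatedGreen_zero (x w : ℂ) (r : ℝ) :
    CircleIntegrable (fun z => truncatedGreen 0 z w) x r := by
  have h := ((circleIntegrable_log_norm_sub_const (a := (starRingEnd ℂ) w) (c := x) r).sub
    (circleIntegrable_log_norm_sub_const (a := w) (c := x) r)).const_mul (1 / Real.pi)
  unfold truncatedGreen
  simp only [max_eq_right (norm_nonneg _)]
  exact h

/-- Averaging leaves the harmonic term log |z - w̄| unchanged and turns log |z - w| into log max(r,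
|x - w|). Thus averaging over radius r is exactly truncation at distance r. -/
theorem circleAverage_truncatedGreen_zero {x w : ℂ} {r : ℝ} (hr : 0 < r)
    (h : closedBall x r ⊆ {z | 0 < z.im}) (hw : 0 < w.im) :
    Real.circleAverage (fun z => truncatedGreen 0 z w) x r = truncatedGreen r x w := by
  have h1 : (fun z => truncatedGreen 0 z w) = (1 / Real.pi) •
      ((fun z => Real.log ‖z - (starRingEnd ℂ) w‖) - fun z => Real.log ‖z - w‖) := by
    ext z
    simp [truncatedGreen]
  rw [h1, Real.circleAverage_smul, Real.circleAverage_sub (circleIntegrable_log_norm_sub_const r)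
    (circleIntegrable_log_norm_sub_const r), circleAverage_log_norm_sub_conj hr h hw,
    circleAverage_log_norm_sub x w hr, truncatedGreen, smul_eq_mul]

theorem ae_circleMap_ne (x w : ℂ) {r : ℝ} (hr : 0 < r) :
    ∀ᵐ θ : ℝ, circleMap x r θ ≠ w :=
  ((countable_singleton w).preimage_circleMap x hr.ne').ae_notMem _

/-- Off the pole, the truncation is the minimum of the Green kernel and the harmonic function (log
|z - w̄| - log δ)/π. Its average is at most either average; the case split picks the one that is at
most the central value. -/
theorem isSuperharmonicCl_truncatedGreen {Ω : Set ℂ} (hΩ : closure Ω ⊆ {z | 0 < z.im}) {δ : ℝ}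
    (hδ : 0 < δ) {w : ℂ} (hw : 0 < w.im) : IsSuperharmonicCl (fun z => truncatedGreen δ z w) Ω := by
  have hcont := (continuousOn_truncatedGreen hδ hw).mono hΩ
  refine ⟨hcont, fun x r hr h => ?_⟩
  have h' := h.trans (subset_closure.trans hΩ)
  have hint := circleIntegrable_of_continuousOn_closure hcont hr h
  have h1 : Real.circleAverage (fun z => truncatedGreen δ z w) x r ≤ truncatedGreen r x w := by
    rw [← circleAverage_truncatedGreen_zero hr h' hw]
    refine mul_le_mul_of_nonneg_left (intervalIntegral.integral_mono_ae (by positivity) hint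
      (circleIntegrable_truncatedGreen_zero x w r) ?_) (by positivity)
    filter_upwards [ae_circleMap_ne x w hr] with θ hθ
    exact truncatedGreen_anti hδ.le (max_pos_of_ne 0 hθ)
  rcases le_total δ (max r ‖x - w‖) with hd | hd
  · refine h1.trans ?_
    unfold truncatedGreen
    have : max δ ‖x - w‖ ≤ max r ‖x - w‖ := max_le hd (le_max_right _ _)
    have : 0 < max δ ‖x - w‖ := lt_max_of_lt_left hδ
    gcongr
  · have hx : max δ ‖x - w‖ = δ := max_eq_left ((le_max_right _ _).trans hd)
    have h2 : truncatedGreen δ x w = Real.circleAverage ((1 / Real.pi) •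
        ((fun z => Real.log ‖z - (starRingEnd ℂ) w‖) - fun _ => Real.log δ)) x r := by
      rw [Real.circleAverage_smul, Real.circleAverage_sub (circleIntegrable_log_norm_sub_const r)
        (circleIntegrable_const _ _ _), circleAverage_log_norm_sub_conj hr h' hw,
        Real.circleAverage_const, truncatedGreen, hx, smul_eq_mul]
    rw [h2]
    refine Real.circleAverage_mono hint (((circleIntegrable_log_norm_sub_const r).sub
      (circleIntegrable_const _ _ _)).const_smul) fun z _ => ?_
    simp only [truncatedGreen, Pi.smul_apply, Pi.sub_apply, smul_eq_mul]
    gcongr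
    exact le_max_left _ _

theorem lintegral_ofReal_circleMap {f : ℂ → ℝ} {x : ℂ} {r : ℝ} (hf : CircleIntegrable f x r)
    (h0 : ∀ᵐ θ : ℝ, 0 ≤ f (circleMap x r θ)) :
    ∫⁻ θ in Ioc 0 (2 * Real.pi), ENNReal.ofReal (f (circleMap x r θ)) =
      ENNReal.ofReal (2 * Real.pi) * ENNReal.ofReal (Real.circleAverage f x r) := by
  rw [← ENNReal.ofReal_mul (by positivity), Real.circleAverage_def, smul_eq_mul,
    mul_inv_cancel_left₀ (by positivity), intervalIntegral.integral_of_le (by positivity),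
    ofReal_integral_eq_lintegral_ofReal]
  · exact (intervalIntegrable_iff_integrableOn_Ioc_of_le (by positivity)).1 hf
  · exact ae_restrict_of_ae h0

theorem lintegral_greenKernel_circleMap {x w : ℂ} {r : ℝ} (hr : 0 < r)
    (h : closedBall x r ⊆ {z | 0 < z.im}) (hw : 0 < w.im) :
    ∫⁻ θ in Ioc 0 (2 * Real.pi), greenKernel (circleMap x r θ) w =
      ENNReal.ofReal (2 * Real.pi) * ENNReal.ofReal (truncatedGreen r x w) := by
  have him (θ : ℝ) : 0 < (circleMap x r θ).im :=
    h (sphere_subset_closedBall (circleMap_mem_sphere x hr.le θ))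
  rw [← circleAverage_truncatedGreen_zero hr h hw,
    ← lintegral_ofReal_circleMap (circleIntegrable_truncatedGreen_zero x w r)]
  · refine lintegral_congr_ae (ae_restrict_of_ae ?_)
    filter_upwards [ae_circleMap_ne x w hr] with θ hθ
    exact greenKernel_of_ne (him θ) hw hθ
  · filter_upwards [ae_circleMap_ne x w hr] with θ hθ
    exact truncatedGreen_nonneg (him θ) hw (add_pos (him θ) hw).le (max_pos_of_ne 0 hθ)

/-- The circle averages of the Green kernel are strictly below the central value when the pole is
inside the circle. -/
theorem ofReal_truncatedGreen_lt {x w : ℂ} {r : ℝ} (hx : 0 < x.im) (hw : 0 < w.im)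
    (hxw : ‖x - w‖ < r) (hr : r ≤ x.im) :
    ENNReal.ofReal (truncatedGreen r x w) < greenKernel x w := by
  rcases eq_or_ne x w with rfl | h
  · rw [greenKernel_self]
    exact ENNReal.ofReal_lt_top
  · have hlt : truncatedGreen r x w < truncatedGreen 0 x w := by
      unfold truncatedGreen
      have := max_pos_of_ne 0 h
      have h3 : max 0 ‖x - w‖ < max r ‖x - w‖ := by
        rw [max_eq_right (norm_nonneg _), max_eq_left hxw.le]
        exact hxw
      gcongr
    rw [greenKernel_of_ne hx hw h, ENNReal.ofReal_lt_ofReal_iff_of_nonneg]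
    · exact hlt
    · exact truncatedGreen_nonneg hx hw (by linarith) (max_pos_of_ne r h)

/-! ### Measures on Γ and mutual energy -/

theorem IsMeasureOn.ae_mem {Γ : Set ℂ} {μ : Measure ℂ} (h : IsMeasureOn Γ μ) : ∀ᵐ x ∂μ, x ∈ Γ :=
  h.2

theorem IsMeasureOn.mono {Γ Γ' : Set ℂ} {μ : Measure ℂ} (h : IsMeasureOn Γ μ) (hΓ : Γ ⊆ Γ') :
    IsMeasureOn Γ' μ :=
  ⟨h.1, measure_mono_null (compl_subset_compl.2 hΓ) h.2⟩

theorem IsMeasureOn.restrict {Γ : Set ℂ} {μ : Measure ℂ} (h : IsMeasureOn Γ μ) (s : Set ℂ) :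
    IsMeasureOn Γ (μ.restrict s) :=
  have := h.1
  ⟨inferInstance, Measure.restrict_le_self.absolutelyContinuous h.2⟩

theorem IsMeasureOn.add {Γ : Set ℂ} {μ ν : Measure ℂ} (hμ : IsMeasureOn Γ μ)
    (hν : IsMeasureOn Γ ν) : IsMeasureOn Γ (μ + ν) := by
  have := hμ.1
  have := hν.1
  exact ⟨inferInstance, by simp [hμ.2, hν.2]⟩

theorem IsMeasureOn.smul {Γ : Set ℂ} {μ : Measure ℂ} (h : IsMeasureOn Γ μ) (t : ℝ≥0) :
    IsMeasureOn Γ (t • μ) := by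
  have := h.1
  exact ⟨inferInstance, by simp [h.2]⟩

theorem IsMeasureOn.integrable {Γ : Set ℂ} (hΓ : IsCompact Γ) {μ : Measure ℂ}
    (h : IsMeasureOn Γ μ) {f : ℂ → ℝ} (hf : ContinuousOn f Γ) : Integrable f μ := by
  have := h.1
  rw [← Measure.restrict_eq_self_of_ae_mem h.ae_mem]
  exact hf.integrableOn_compact hΓ

theorem measurable_greenPotential (μ : Measure ℂ) [SFinite μ] : Measurable (greenPotential μ) :=
  measurable_greenKernel.lintegral_prod_right'

/-- The mutual Green energy of two measures. -/
def mutualEnergy (μ ν : Measure ℂ) : ℝ≥0∞ := ∫⁻ z, greenPotential μ z ∂ν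

theorem mutualEnergy_comm (μ ν : Measure ℂ) [SFinite μ] [SFinite ν] :
    mutualEnergy μ ν = mutualEnergy ν μ := by
  unfold mutualEnergy greenPotential
  rw [lintegral_lintegral_swap measurable_greenKernel.aemeasurable]
  simp_rw [greenKernel_comm]

theorem mutualEnergy_add_right (μ ν ν' : Measure ℂ) :
    mutualEnergy μ (ν + ν') = mutualEnergy μ ν + mutualEnergy μ ν' :=
  lintegral_add_measure _ _ _

theorem mutualEnergy_smul_right (t : ℝ≥0) (μ ν : Measure ℂ) :
    mutualEnergy μ (t • ν) = t * mutualEnergy μ ν :=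
  lintegral_smul_measure _ _

theorem mutualEnergy_add_smul (t : ℝ≥0) (μ ν : Measure ℂ) [SFinite μ] [SFinite ν] :
    mutualEnergy (μ + t • ν) (μ + t • ν) =
      mutualEnergy μ μ + 2 * t * mutualEnergy μ ν + t ^ 2 * mutualEnergy ν ν := by
  rw [mutualEnergy_add_right, mutualEnergy_smul_right, mutualEnergy_comm _ μ,
    mutualEnergy_comm _ ν]
  simp only [mutualEnergy_add_right, mutualEnergy_smul_right, mutualEnergy_comm ν μ]
  ring

/-! ### The lower bound Gμ ≥ φ -/

theorem lintegral_greenKernel_le_of_swept {Ω : Set ℂ} (hΩb : Bornology.IsBounded Ω)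
    (hΩ : closure Ω ⊆ {z | 0 < z.im}) {z : ℂ} (hz : 0 < z.im) {ν : Measure ℂ}
    (hν : IsMeasureOn (frontier Ω) ν)
    (hs : ∀ s, IsSuperharmonicCl s Ω → ∫ x, s x ∂ν ≤ s z) {w : ℂ} (hw : 0 < w.im) :
    ∫⁻ x, greenKernel x w ∂ν ≤ greenKernel z w := by
  have hK : IsCompact (frontier Ω) :=
    hΩb.isCompact_closure.of_isClosed_subset isClosed_frontier frontier_subset_closure
  -- The factor `w.im` keeps δ ≤ Im x + Im w, so that the truncated kernels are nonnegative on ∂Ω.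
  let δ : ℕ → ℝ := fun n => w.im * (1 / ((n : ℝ) + 1))
  have hδ : Tendsto δ atTop (𝓝 0) := by
    have := (tendsto_one_div_add_atTop_nhds_zero_nat (𝕜 := ℝ)).const_mul w.im
    rwa [mul_zero] at this
  have hδ0 (n : ℕ) : 0 < δ n := by positivity
  have hδ1 (n : ℕ) : δ n ≤ w.im := by
    refine mul_le_of_le_one_right hw.le ?_
    rw [div_le_one (by positivity)]
    simp
  have him : ∀ᵐ x ∂ν, 0 < x.im := hν.ae_mem.mono fun x hx => hΩ (frontier_subset_closure hx)
  have hmeas (n : ℕ) : Measurable fun x => ENNReal.ofReal (truncatedGreen (δ n) x w) := by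
    unfold truncatedGreen
    fun_prop
  calc ∫⁻ x, greenKernel x w ∂ν
      ≤ ∫⁻ x, liminf (fun n => ENNReal.ofReal (truncatedGreen (δ n) x w)) atTop ∂ν :=
        lintegral_mono_ae (him.mono fun x hx => greenKernel_le_liminf hx hw hδ hδ0)
    _ ≤ liminf (fun n => ∫⁻ x, ENNReal.ofReal (truncatedGreen (δ n) x w) ∂ν) atTop :=
        lintegral_liminf_le hmeas
    _ ≤ liminf (fun _ : ℕ => greenKernel z w) atTop := by
        refine liminf_le_liminf (Eventually.of_forall fun n => ?_)
        have hsup := isSuperharmonicCl_truncatedGreen hΩ (hδ0 n) hw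
        rw [← ofReal_integral_eq_lintegral_ofReal
          (hν.integrable hK (hsup.1.mono frontier_subset_closure))]
        · exact (ENNReal.ofReal_le_ofReal (hs _ hsup)).trans
            (ofReal_truncatedGreen_le hz hw (hδ0 n).le)
        · filter_upwards [him] with x hx
          exact truncatedGreen_nonneg hx hw (by linarith [hδ1 n]) (lt_max_of_lt_left (hδ0 n))
    _ = greenKernel z w := liminf_const _

theorem ofReal_integral_le_lintegral_ofReal {α : Type*} [MeasurableSpace α] {μ : Measure α}
    {f : α → ℝ} (hf : Integrable f μ) :
    ENNReal.ofReal (∫ x, f x ∂μ) ≤ ∫⁻ x, ENNReal.ofReal (f x) ∂μ := by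
  have h : Integrable (fun x => max (f x) 0) μ := hf.pos_part
  refine (ENNReal.ofReal_le_ofReal (integral_mono hf h fun x => le_max_left _ _)).trans ?_
  rw [ofReal_integral_eq_lintegral_ofReal h (Eventually.of_forall fun x => le_max_right _ _)]
  simp

/-- If the integral of a potential against every measure of finite energy on the boundary is at
least that of the harmonic function `φ`, then the potential is at least `φ` inside. -/
theorem ofReal_le_greenPotential {Ω : Set ℂ} (hΩ : IsOpen Ω) (hΩb : Bornology.IsBounded Ω)
    (him : closure Ω ⊆ {z | 0 < z.im}) {φ : ℂ → ℝ} (hφ : ContinuousOn φ (closure Ω))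
    (hφΩ : InnerProductSpace.HarmonicOnNhd φ Ω) {μ : Measure ℂ} [SFinite μ]
    (hμ : ∀ᵐ w ∂μ, 0 < w.im)
    (h : ∀ ν, IsMeasureOn (frontier Ω) ν → mutualEnergy ν ν ≠ ⊤ →
      ENNReal.ofReal (∫ x, φ x ∂ν) ≤ mutualEnergy μ ν) {z : ℂ} (hz : z ∈ Ω) :
    ENNReal.ofReal (φ z) ≤ greenPotential μ z := by
  obtain ⟨ν, hν, hs⟩ := exists_swept_measure hΩ hΩb hz
  have hfin := hν.1
  have hzim : 0 < z.im := him (subset_closure hz)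
  have hker {w : ℂ} (hw : 0 < w.im) := lintegral_greenKernel_le_of_swept hΩb him hzim hν hs hw
  have hνim : ∀ᵐ x ∂ν, 0 < x.im := hν.ae_mem.mono fun x hx => him (frontier_subset_closure hx)
  have hle {κ : Measure ℂ} [SFinite κ] (hκ : ∀ᵐ w ∂κ, 0 < w.im) :
      mutualEnergy κ ν ≤ greenPotential κ z := by
    rw [mutualEnergy, greenPotential]
    unfold greenPotential
    rw [lintegral_lintegral_swap measurable_greenKernel.aemeasurable]
    exact lintegral_mono_ae (hκ.mono fun w hw => hker hw)
  -- Sweeping is applied to the superharmonic function -φ.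
  have hφν : φ z ≤ ∫ x, φ x ∂ν := by
    have := hs _ (hφΩ.neg.isSuperharmonicCl hφ.neg)
    simp only [Pi.neg_apply, integral_neg] at this
    linarith
  refine (ENNReal.ofReal_le_ofReal hφν).trans ((h ν hν ?_).trans (hle hμ))
  -- The energy of ν is at most Gν(z), which is finite because ν lives at positive distance from z.
  refine ne_top_of_le_ne_top ?_ (hle hνim)
  obtain ⟨d, hd, hdΩ⟩ := nhds_basis_ball.mem_iff.1 (hΩ.mem_nhds hz)
  obtain ⟨R, -, hR⟩ := hΩb.closure.exists_pos_norm_lt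
  have hbound : ∀ᵐ w ∂ν, greenKernel z w ≤
      ENNReal.ofReal (1 / Real.pi * Real.log ((‖z‖ + R) / d)) := by
    filter_upwards [hν.ae_mem] with w hw
    have hwim : 0 < w.im := him (frontier_subset_closure hw)
    have hwΩ : w ∉ Ω := fun hmem => (hΩ.frontier_eq ▸ hw).2 hmem
    have hne : z ≠ w := fun h => hwΩ (h ▸ hz)
    have hdw : d ≤ ‖z - w‖ := by
      by_contra! hlt
      exact hwΩ (hdΩ (by rwa [mem_ball, dist_eq_norm, norm_sub_rev]))
    rw [greenKernel, if_neg hne, norm_div]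
    have h1 : 0 < ‖z - (starRingEnd ℂ) w‖ := norm_pos_iff.2 (sub_conj_ne_zero hzim hwim)
    have h2 : ‖z - (starRingEnd ℂ) w‖ ≤ ‖z‖ + R := by
      refine (norm_sub_le _ _).trans ?_
      rw [Complex.norm_conj]
      exact add_le_add le_rfl (hR w (frontier_subset_closure hw)).le
    have h3 : 0 < ‖z - w‖ := hd.trans_le hdw
    have h4 : 0 ≤ ‖z‖ + R := h1.le.trans h2
    gcongr
  refine ne_top_of_le_ne_top ?_ (lintegral_mono_ae hbound)
  rw [lintegral_const]
  exact ENNReal.mul_ne_top ENNReal.ofReal_ne_top (measure_ne_top _ _)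

/-! ### Equality in the mean value inequality -/

/-- Averaging Gμ ≥ φ over the circle and using Gμ(x) ≤ φ(x)⁺ shows that truncating the kernel at
distance r does not lower its μ-integral. Truncation strictly lowers the kernel at every pole in the
disk, so no mass lies there. -/
theorem measure_ball_eq_zero {Ω : Set ℂ} (him : Ω ⊆ {z | 0 < z.im}) {φ : ℂ → ℝ}
    (hφΩ : InnerProductSpace.HarmonicOnNhd φ Ω) {μ : Measure ℂ} [SFinite μ]
    (hμ : ∀ᵐ w ∂μ, 0 < w.im) (h : ∀ z ∈ Ω, ENNReal.ofReal (φ z) ≤ greenPotential μ z)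
    {x : ℂ} {r : ℝ} (hr : 0 < r) (hrΩ : closedBall x r ⊆ Ω)
    (hx : greenPotential μ x ≤ ENNReal.ofReal (φ x)) : μ (ball x r) = 0 := by
  have hxim : 0 < x.im := him (hrΩ (mem_closedBall_self hr.le))
  -- Otherwise the disk would contain the real point x - i Im x.
  have hrx : r ≤ x.im := by
    by_contra! hlt
    have : (0 : ℝ) < (x - (x.im : ℂ) * Complex.I).im := him (hrΩ (by
      simp [mem_closedBall, abs_of_pos hxim, hlt.le]))
    simp at this
  have hφint : CircleIntegrable φ x r :=
    ((hφΩ.continuousOn).mono (sphere_subset_closedBall.trans hrΩ)).circleIntegrable hr.le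
  have hφavg : Real.circleAverage φ x r = φ x :=
    InnerProductSpace.HarmonicOnNhd.circleAverage_eq (hφΩ.mono (by rwa [abs_of_pos hr]))
  have hc0 : ENNReal.ofReal (2 * Real.pi) ≠ 0 := by
    rw [Ne, ENNReal.ofReal_eq_zero, not_le]; positivity
  have key : ENNReal.ofReal (2 * Real.pi) * ENNReal.ofReal (φ x) ≤
      ENNReal.ofReal (2 * Real.pi) * ∫⁻ w, ENNReal.ofReal (truncatedGreen r x w) ∂μ := by
    calc ENNReal.ofReal (2 * Real.pi) * ENNReal.ofReal (φ x)
        = ENNReal.ofReal (∫ θ in Ioc 0 (2 * Real.pi), φ (circleMap x r θ)) := by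
          rw [← hφavg, ← ENNReal.ofReal_mul (by positivity), Real.circleAverage_def, smul_eq_mul,
            mul_inv_cancel_left₀ (by positivity), intervalIntegral.integral_of_le (by positivity)]
      _ ≤ ∫⁻ θ in Ioc 0 (2 * Real.pi), ENNReal.ofReal (φ (circleMap x r θ)) :=
          ofReal_integral_le_lintegral_ofReal
            ((intervalIntegrable_iff_integrableOn_Ioc_of_le (by positivity)).1 hφint)
      _ ≤ ∫⁻ θ in Ioc 0 (2 * Real.pi), greenPotential μ (circleMap x r θ) :=
          lintegral_mono fun θ =>
            h _ (hrΩ (sphere_subset_closedBall (circleMap_mem_sphere x hr.le θ)))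
      _ = ∫⁻ w, (∫⁻ θ in Ioc 0 (2 * Real.pi), greenKernel (circleMap x r θ) w) ∂μ := by
          unfold greenPotential
          refine lintegral_lintegral_swap (Measurable.aemeasurable ?_)
          exact measurable_greenKernel.comp
            (((continuous_circleMap x r).measurable.comp measurable_fst).prodMk measurable_snd)
      _ = ∫⁻ w, ENNReal.ofReal (2 * Real.pi) * ENNReal.ofReal (truncatedGreen r x w) ∂μ :=
          lintegral_congr_ae (hμ.mono fun w hw =>
            lintegral_greenKernel_circleMap hr (hrΩ.trans him) hw)
      _ = _ := lintegral_const_mul' _ _ ENNReal.ofReal_ne_top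
  rw [ENNReal.mul_le_mul_iff_right hc0 ENNReal.ofReal_ne_top] at key
  have hle : (fun w => ENNReal.ofReal (truncatedGreen r x w)) ≤ᵐ[μ] fun w => greenKernel x w :=
    hμ.mono fun w hw => ofReal_truncatedGreen_le hxim hw hr.le
  have heq := ae_eq_of_ae_le_of_lintegral_le hle
    (ne_top_of_le_ne_top ENNReal.ofReal_ne_top ((lintegral_mono_ae hle).trans hx))
    (measurable_greenKernel.comp measurable_prodMk_left).aemeasurable (hx.trans key)
  have hnot : ∀ᵐ w ∂μ, w ∉ ball x r := by
    filter_upwards [heq, hμ] with w hw hwim hmem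
    rw [mem_ball, dist_eq_norm, norm_sub_rev] at hmem
    exact (ofReal_truncatedGreen_lt hxim hwim hmem hrx).ne hw
  exact measure_eq_zero_iff_ae_notMem.2 hnot

theorem measure_eq_zero_of_greenPotential {Ω : Set ℂ} (hΩ : IsOpen Ω) (him : Ω ⊆ {z | 0 < z.im})
    {φ : ℂ → ℝ} (hφΩ : InnerProductSpace.HarmonicOnNhd φ Ω) {μ : Measure ℂ} [SFinite μ]
    (hμ : ∀ᵐ w ∂μ, 0 < w.im) (h : ∀ z ∈ Ω, ENNReal.ofReal (φ z) ≤ greenPotential μ z)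
    (h' : ∀ᵐ z ∂μ, z ∈ Ω → greenPotential μ z ≤ ENNReal.ofReal (φ z)) : μ Ω = 0 := by
  have hA : μ {z | z ∈ Ω ∧ greenPotential μ z ≤ ENNReal.ofReal (φ z)} = 0 := by
    refine measure_null_of_locally_null _ fun x hx => ?_
    obtain ⟨r, hr, hrΩ⟩ := nhds_basis_closedBall.mem_iff.1 (hΩ.mem_nhds hx.1)
    exact ⟨ball x r, mem_nhdsWithin_of_mem_nhds (ball_mem_nhds x hr),
      measure_ball_eq_zero him hφΩ hμ h hr hrΩ hx.2⟩
  refine measure_mono_null (t := {z | z ∈ Ω ∧ greenPotential μ z ≤ ENNReal.ofReal (φ z)} ∪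
    {z | ¬ (z ∈ Ω → greenPotential μ z ≤ ENNReal.ofReal (φ z))}) (fun z hz => ?_)
    (measure_union_null hA h')
  by_cases hc : greenPotential μ z ≤ ENNReal.ofReal (φ z)
  · exact Or.inl ⟨hz, hc⟩
  · exact Or.inr fun hh => hc (hh hz)

/-- Im is harmonic and has a positive lower bound on the compact boundary, so the minimum principle
carries positivity inside. -/
theorem closure_subset_upperHalfPlane {Ω : Set ℂ} (hΩ : IsOpen Ω) (hΩb : Bornology.IsBounded Ω)
    (h : ∀ z ∈ frontier Ω, 0 < z.im) : closure Ω ⊆ {z | 0 < z.im} := by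
  have hK : IsCompact (frontier Ω) :=
    hΩb.isCompact_closure.of_isClosed_subset isClosed_frontier frontier_subset_closure
  obtain ⟨c, hc, hcf⟩ := hK.exists_forall_le' Complex.continuous_im.continuousOn h
  have hs : IsSuperharmonicCl Complex.im Ω := by
    refine InnerProductSpace.HarmonicOnNhd.isSuperharmonicCl (fun z _ => ?_)
      Complex.continuous_im.continuousOn
    have : InnerProductSpace.HarmonicAt (fun z : ℂ => (-Complex.I * z).re) z :=
      AnalyticAt.harmonicAt_re (by fun_prop)
    simpa using this
  intro z hz
  by_cases hzΩ : z ∈ Ω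
  · exact hc.trans_le (hs.le_of_le_frontier hΩ hΩb hcf hzΩ)
  · exact h z ⟨hz, by rwa [hΩ.interior_eq]⟩

/-! ### First-order conditions for energy minimizers -/

theorem energy_eq (ρ : Measure ℂ) (σ : ℂ → ℝ≥0) (φ : ℂ → ℝ) (μ : Measure ℂ) :
    energy ρ σ φ μ = (mutualEnergy μ μ : EReal) - ((2 * ∫ z, φ z ∂μ : ℝ) : EReal)
      + (sigmaTerm ρ σ μ : EReal) := rfl

theorem coe_toReal_energy {e s : ℝ≥0∞} (he : e ≠ ⊤) (hs : s ≠ ⊤) (q : ℝ) :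
    (e : EReal) - (q : EReal) + (s : EReal) = ((e.toReal - q + s.toReal : ℝ) : EReal) := by
  lift e to ℝ≥0 using he
  lift s to ℝ≥0 using hs
  rfl

theorem energy_zero (ρ : Measure ℂ) (σ : ℂ → ℝ≥0) (φ : ℂ → ℝ) : energy ρ σ φ 0 = 0 := by
  have h : sigmaTerm ρ σ 0 = 0 := by
    refine le_antisymm ((iInf₂_le (fun _ => 0) ⟨measurable_const, ?_⟩).trans ?_) zero_le
    · simp
    · simp only [ENNReal.coe_zero, mul_zero]
      rw [withDensity_const]
      simp
  simp [energy_eq, mutualEnergy, h]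

theorem mutualEnergy_self_ne_top_of_energy_le_zero {ρ : Measure ℂ} {σ : ℂ → ℝ≥0} {φ : ℂ → ℝ}
    {μ : Measure ℂ} (h : energy ρ σ φ μ ≤ 0) : mutualEnergy μ μ ≠ ⊤ := by
  intro he
  rw [energy_eq, he, EReal.coe_ennreal_top, EReal.top_sub_coe,
    EReal.top_add_of_ne_bot (EReal.coe_ennreal_ne_bot _), top_le_iff] at h
  exact EReal.zero_ne_top h

theorem sigmaTerm_ne_top_of_energy_le_zero {ρ : Measure ℂ} {σ : ℂ → ℝ≥0} {φ : ℂ → ℝ}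
    {μ : Measure ℂ} (h : energy ρ σ φ μ ≤ 0) : sigmaTerm ρ σ μ ≠ ⊤ := by
  intro hs
  have he := mutualEnergy_self_ne_top_of_energy_le_zero h
  rw [energy_eq, hs, EReal.coe_ennreal_top, EReal.add_top_of_ne_bot, top_le_iff] at h
  · exact EReal.zero_ne_top h
  · lift mutualEnergy μ μ to ℝ≥0 using he with e
    exact EReal.coe_ne_bot ((e : ℝ) - 2 * ∫ z, φ z ∂μ)

theorem IsEnergyMinimizer.energy_le_zero {Γ : Set ℂ} {ρ : Measure ℂ} {σ : ℂ → ℝ≥0} {φ : ℂ → ℝ}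
    {μ : Measure ℂ} (h : IsEnergyMinimizer Γ ρ σ φ μ) : energy ρ σ φ μ ≤ 0 :=
  (h.2 0 ⟨inferInstance, rfl⟩).trans_eq (energy_zero ρ σ φ)

/-- Comparison with the zero measure makes the energy of the minimizer finite, so minimality can be
read in ℝ. For the competitor, any finite upper bound of its σ-term suffices. -/
theorem IsEnergyMinimizer.toReal_le {Γ : Set ℂ} {ρ : Measure ℂ} {σ : ℂ → ℝ≥0} {φ : ℂ → ℝ}
    {μ : Measure ℂ} (h : IsEnergyMinimizer Γ ρ σ φ μ) {ν : Measure ℂ} (hν : IsMeasureOn Γ ν)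
    (he : mutualEnergy ν ν ≠ ⊤) {s : ℝ≥0∞} (hs : s ≠ ⊤) (hle : sigmaTerm ρ σ ν ≤ s) :
    (mutualEnergy μ μ).toReal - 2 * ∫ z, φ z ∂μ + (sigmaTerm ρ σ μ).toReal ≤
      (mutualEnergy ν ν).toReal - 2 * ∫ z, φ z ∂ν + s.toReal := by
  have hνμ := h.2 ν hν
  rw [energy_eq, energy_eq, coe_toReal_energy
    (mutualEnergy_self_ne_top_of_energy_le_zero h.energy_le_zero)
    (sigmaTerm_ne_top_of_energy_le_zero h.energy_le_zero),
    coe_toReal_energy he (ne_top_of_le_ne_top hs hle), EReal.coe_le_coe_iff] at hνμ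
  linarith [ENNReal.toReal_mono hs hle]

theorem nonneg_of_forall_quadratic_nonneg {a b : ℝ}
    (h : ∀ t : ℝ≥0, t ≤ 1 → 0 ≤ t * a + t ^ 2 * b) : 0 ≤ a := by
  by_contra! ha
  have hd : 0 < |b| + -a := by linarith [abs_nonneg b]
  -- With this t the quadratic term absorbs at most half of the negative linear one.
  let t : ℝ≥0 := ⟨-a / (2 * (|b| + -a)), by have := neg_pos.2 ha; positivity⟩
  have ht : (t : ℝ) = -a / (2 * (|b| + -a)) := rfl
  have ht0 : 0 < (t : ℝ) := by rw [ht]; have := neg_pos.2 ha; positivity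
  have ht1 : t ≤ 1 := by
    rw [← NNReal.coe_le_coe, ht, NNReal.coe_one, div_le_one (by positivity)]
    linarith [abs_nonneg b]
  have h1 := h t ht1
  have h2 : 0 ≤ (t : ℝ) * (a + t * b) := by linarith
  have h3 := nonneg_of_mul_nonneg_right h2 ht0
  have h4 : (t : ℝ) * b ≤ t * (|b| + -a) := by
    gcongr
    linarith [le_abs_self b]
  have h5 : (t : ℝ) * (|b| + -a) = -a / 2 := by rw [ht]; field_simp
  linarith

/-- Since σν = 0, every density of μ is also a density of μ + tν. -/
theorem sigmaTerm_add_le {ρ : Measure ℂ} {σ : ℂ → ℝ≥0} {μ ν : Measure ℂ}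
    (h : ∀ᵐ z ∂ν, σ z = 0) (t : ℝ≥0) : sigmaTerm ρ σ (μ + t • ν) ≤ sigmaTerm ρ σ μ := by
  refine le_iInf₂ fun u hu => iInf₂_le u ⟨hu.1, ?_⟩
  have h0 : ν.withDensity (fun z => (σ z : ℝ≥0∞)) = 0 := by
    rw [withDensity_congr_ae (g := 0) (h.mono fun z hz => by simp [hz]), withDensity_zero]
  have h1 : (t • ν).withDensity (fun z => (σ z : ℝ≥0∞)) = 0 := by
    have := withDensity_smul_measure (μ := ν) (t : ℝ≥0∞) (fun z => (σ z : ℝ≥0∞))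
    rw [h0, smul_zero] at this
    exact this
  rw [withDensity_add_measure, h1, add_zero, hu.2]

/-- The potential of a minimizer integrates to at least `∫ φ dν` for every measure `ν` of finite
energy carried by the zero set of `σ`. -/
theorem IsEnergyMinimizer.ofReal_integral_le {Γ : Set ℂ} (hΓ : IsCompact Γ) {ρ : Measure ℂ}
    {σ : ℂ → ℝ≥0} {φ : ℂ → ℝ} (hφ : ContinuousOn φ Γ) {μ : Measure ℂ}
    (h : IsEnergyMinimizer Γ ρ σ φ μ) {ν : Measure ℂ} (hν : IsMeasureOn Γ ν)
    (hσ : ∀ᵐ z ∂ν, σ z = 0) (he : mutualEnergy ν ν ≠ ⊤) :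
    ENNReal.ofReal (∫ x, φ x ∂ν) ≤ mutualEnergy μ ν := by
  have := h.1.1
  have := hν.1
  rcases eq_or_ne (mutualEnergy μ ν) ⊤ with htop | htop
  · rw [htop]; exact le_top
  have heμ := mutualEnergy_self_ne_top_of_energy_le_zero h.energy_le_zero
  have hsμ := sigmaTerm_ne_top_of_energy_le_zero h.energy_le_zero
  -- This is the coefficient of t in J(μ + tν) - J(μ), with the unchanged upper bound for the
  -- σ-term.
  have key : 0 ≤ 2 * ((mutualEnergy μ ν).toReal - ∫ x, φ x ∂ν) := by
    refine nonneg_of_forall_quadratic_nonneg (b := (mutualEnergy ν ν).toReal) fun t _ => ?_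
    have hadd := mutualEnergy_add_smul t μ ν
    have hcross : 2 * (t : ℝ≥0∞) * mutualEnergy μ ν ≠ ⊤ :=
      ENNReal.mul_ne_top (ENNReal.mul_ne_top (by simp) ENNReal.coe_ne_top) htop
    have hsq : (t : ℝ≥0∞) ^ 2 * mutualEnergy ν ν ≠ ⊤ :=
      ENNReal.mul_ne_top (ENNReal.pow_ne_top ENNReal.coe_ne_top) he
    have hle := h.toReal_le (h.1.add (hν.smul t))
      (by rw [hadd]; exact ENNReal.add_ne_top.2 ⟨ENNReal.add_ne_top.2 ⟨heμ, hcross⟩, hsq⟩)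
      hsμ (sigmaTerm_add_le hσ t)
    rw [hadd, ENNReal.toReal_add (ENNReal.add_ne_top.2 ⟨heμ, hcross⟩) hsq,
      ENNReal.toReal_add heμ hcross,
      integral_add_measure (h.1.integrable hΓ hφ) ((hν.smul t).integrable hΓ hφ),
      integral_smul_nnreal_measure] at hle
    simp only [ENNReal.toReal_mul, ENNReal.toReal_pow, ENNReal.coe_toReal,
      ENNReal.toReal_ofNat, NNReal.smul_def, smul_eq_mul] at hle
    linarith
  exact ENNReal.ofReal_le_of_le_toReal (by linarith)

theorem IsSigmaDensity.add_smul_restrict {ρ : Measure ℂ} {σ : ℂ → ℝ≥0} {μ : Measure ℂ}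
    {u : ℂ → ℝ≥0} (hu : IsSigmaDensity ρ σ μ u) {A : Set ℂ} (hA : MeasurableSet A) (t : ℝ≥0)
    [DecidablePred (· ∈ A)] :
    IsSigmaDensity ρ σ (μ.restrict Aᶜ + t • μ.restrict A)
      (fun z => if z ∈ A then t * u z else u z) := by
  refine ⟨Measurable.ite hA (hu.1.const_mul t) hu.1, ?_⟩
  have hs := withDensity_smul_measure (μ := μ.restrict A) (t : ℝ≥0∞) (fun z => (σ z : ℝ≥0∞))
  rw [← Measure.restrict_compl_add_restrict (μ := ρ.withDensity fun z => (σ z : ℝ≥0∞) *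
    ((if z ∈ A then t * u z else u z : ℝ≥0) : ℝ≥0∞)) hA, restrict_withDensity hA.compl,
    restrict_withDensity hA, withDensity_add_measure]
  congr 1
  · rw [← restrict_withDensity hA.compl, hu.2, restrict_withDensity hA.compl]
    refine withDensity_congr_ae ?_
    filter_upwards [ae_restrict_mem hA.compl] with z hz
    rw [if_neg hz]
  · refine hs.trans ?_
    rw [← restrict_withDensity hA, hu.2, restrict_withDensity hA,
      ← withDensity_smul' _ _ ENNReal.coe_ne_top]
    refine withDensity_congr_ae ?_
    filter_upwards [ae_restrict_mem hA] with z hz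
    simp only [Pi.smul_apply, smul_eq_mul, if_pos hz, ENNReal.coe_mul]
    ring

theorem sigmaTerm_add_smul_restrict_le {ρ : Measure ℂ} {σ : ℂ → ℝ≥0} {μ : Measure ℂ}
    {u : ℂ → ℝ≥0} (hu : IsSigmaDensity ρ σ μ u) {A : Set ℂ} (hA : MeasurableSet A) (t : ℝ≥0) :
    sigmaTerm ρ σ (μ.restrict Aᶜ + t • μ.restrict A) ≤
      ∫⁻ z in Aᶜ, (σ z : ℝ≥0∞) * (u z : ℝ≥0∞) ^ 2 ∂ρ +
        t ^ 2 * ∫⁻ z in A, (σ z : ℝ≥0∞) * (u z : ℝ≥0∞) ^ 2 ∂ρ := by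
  classical
  refine (iInf₂_le _ (hu.add_smul_restrict hA t)).trans_eq ?_
  rw [← lintegral_add_compl _ hA, add_comm,
    ← lintegral_const_mul' _ _ (ENNReal.pow_ne_top ENNReal.coe_ne_top)]
  congr 1
  · refine lintegral_congr_ae ?_
    filter_upwards [ae_restrict_mem hA.compl] with z hz
    rw [if_neg hz]
  · refine lintegral_congr_ae ?_
    filter_upwards [ae_restrict_mem hA] with z hz
    rw [if_pos hz, ENNReal.coe_mul]
    ring

/-- The competitor multiplies the mass on A by 1 - t. Its first-order condition is ∫_A Gμ dμ + ∫_A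
σu² dρ ≤ ∫_A φ dμ, and the nonnegative σ-term is dropped. -/
theorem IsEnergyMinimizer.setLIntegral_le {Γ : Set ℂ} (hΓ : IsCompact Γ) {ρ : Measure ℂ}
    [IsFiniteMeasure ρ] {σ : ℂ → ℝ≥0} (hσ : AEMeasurable σ ρ) {φ : ℂ → ℝ} (hφ : ContinuousOn φ Γ)
    {μ : Measure ℂ} (h : IsEnergyMinimizer Γ ρ σ φ μ) {A : Set ℂ} (hA : MeasurableSet A) :
    ∫⁻ z in A, greenPotential μ z ∂μ ≤ ENNReal.ofReal (∫ z in A, φ z ∂μ) := by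
  have hfin := h.1.1
  have heμ := mutualEnergy_self_ne_top_of_energy_le_zero h.energy_le_zero
  have hsμ := sigmaTerm_ne_top_of_energy_le_zero h.energy_le_zero
  obtain ⟨u, hu⟩ : ∃ u, IsSigmaDensity ρ σ μ u := by
    by_contra! hno
    exact hsμ (by simp [sigmaTerm, hno])
  have hsum : sigmaTerm ρ σ μ = ∫⁻ z in Aᶜ, (σ z : ℝ≥0∞) * (u z : ℝ≥0∞) ^ 2 ∂ρ +
      ∫⁻ z in A, (σ z : ℝ≥0∞) * (u z : ℝ≥0∞) ^ 2 ∂ρ := by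
    rw [sigmaTerm_eq hσ hu, ← lintegral_add_compl _ hA, add_comm]
  set s₁ := ∫⁻ z in Aᶜ, (σ z : ℝ≥0∞) * (u z : ℝ≥0∞) ^ 2 ∂ρ
  set s₂ := ∫⁻ z in A, (σ z : ℝ≥0∞) * (u z : ℝ≥0∞) ^ 2 ∂ρ
  set a := μ.restrict Aᶜ
  set b := μ.restrict A
  have hab : a + b = μ := Measure.restrict_compl_add_restrict hA
  have hexp (t : ℝ≥0) := mutualEnergy_add_smul t a b
  have hμexp := hexp 1
  rw [one_smul, hab] at hμexp
  simp only [ENNReal.coe_one, mul_one, one_pow, one_mul] at hμexp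
  have hs₁ : s₁ ≠ ⊤ := fun hh => hsμ (by rw [hsum, hh, top_add])
  have hs₂ : s₂ ≠ ⊤ := fun hh => hsμ (by rw [hsum, hh, add_top])
  have haa : mutualEnergy a a ≠ ⊤ := fun hh => heμ (by rw [hμexp, hh, top_add, top_add])
  have hbb : mutualEnergy b b ≠ ⊤ := fun hh => heμ (by rw [hμexp, hh, add_top])
  have hab' : mutualEnergy a b ≠ ⊤ := fun hh => heμ (by
    rw [hμexp, hh, ENNReal.mul_top (by simp), add_top, top_add])
  have ha : IsMeasureOn Γ a := h.1.restrict _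
  have hb : IsMeasureOn Γ b := h.1.restrict _
  have hexpR (t : ℝ≥0) : (mutualEnergy (a + t • b) (a + t • b)).toReal =
      (mutualEnergy a a).toReal + 2 * t * (mutualEnergy a b).toReal
        + t ^ 2 * (mutualEnergy b b).toReal ∧ mutualEnergy (a + t • b) (a + t • b) ≠ ⊤ := by
    have hcross : 2 * (t : ℝ≥0∞) * mutualEnergy a b ≠ ⊤ :=
      ENNReal.mul_ne_top (ENNReal.mul_ne_top (by simp) ENNReal.coe_ne_top) hab'
    have hsq : (t : ℝ≥0∞) ^ 2 * mutualEnergy b b ≠ ⊤ :=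
      ENNReal.mul_ne_top (ENNReal.pow_ne_top ENNReal.coe_ne_top) hbb
    have hac := ENNReal.add_ne_top.2 ⟨haa, hcross⟩
    refine ⟨?_, by rw [hexp]; exact ENNReal.add_ne_top.2 ⟨hac, hsq⟩⟩
    rw [hexp, ENNReal.toReal_add hac hsq, ENNReal.toReal_add haa hcross]
    simp only [ENNReal.toReal_mul, ENNReal.toReal_pow, ENNReal.coe_toReal, ENNReal.toReal_ofNat]
  have hφR (t : ℝ≥0) : ∫ z, φ z ∂(a + t • b) = ∫ z, φ z ∂a + t * ∫ z, φ z ∂b := by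
    rw [integral_add_measure (ha.integrable hΓ hφ) ((hb.smul t).integrable hΓ hφ),
      integral_smul_nnreal_measure, NNReal.smul_def, smul_eq_mul]
  have hμR := (hexpR 1).1
  have hμφ := hφR 1
  rw [one_smul, hab] at hμR hμφ
  have key : 0 ≤ 2 * (∫ z, φ z ∂b - (mutualEnergy a b).toReal - (mutualEnergy b b).toReal
      - s₂.toReal) := by
    -- The restriction t ≤ 1 makes the truncated subtraction `1 - t` in `ℝ≥0` the real one.
    refine nonneg_of_forall_quadratic_nonneg (b := (mutualEnergy b b).toReal + s₂.toReal)
      fun t ht => ?_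
    have hs₂' : ((1 - t : ℝ≥0) : ℝ≥0∞) ^ 2 * s₂ ≠ ⊤ :=
      ENNReal.mul_ne_top (ENNReal.pow_ne_top ENNReal.coe_ne_top) hs₂
    have hle := h.toReal_le (ha.add (hb.smul (1 - t))) (hexpR (1 - t)).2
      (ENNReal.add_ne_top.2 ⟨hs₁, hs₂'⟩) (sigmaTerm_add_smul_restrict_le hu hA (1 - t))
    rw [(hexpR _).1, hφR, hμR, hμφ, hsum, ENNReal.toReal_add hs₁ hs₂,
      ENNReal.toReal_add hs₁ hs₂'] at hle
    simp only [ENNReal.toReal_mul, ENNReal.toReal_pow, ENNReal.coe_toReal,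
      NNReal.coe_sub ht, NNReal.coe_one] at hle
    linarith
  have hGb : ∫⁻ z in A, greenPotential μ z ∂μ = mutualEnergy a b + mutualEnergy b b := by
    have : mutualEnergy μ b = mutualEnergy (a + b) b := by rw [hab]
    refine this.trans ?_
    rw [mutualEnergy_comm, mutualEnergy_add_right, mutualEnergy_comm b a]
  rw [hGb, ← ENNReal.ofReal_toReal (ENNReal.add_ne_top.2 ⟨hab', hbb⟩),
    ENNReal.toReal_add hab' hbb]
  refine ENNReal.ofReal_le_ofReal ?_
  linarith [ENNReal.toReal_nonneg (a := s₂)]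

theorem ofReal_eq_of_add_eq_coe {g : ℝ≥0∞} {s : ℝ≥0} {x : ℝ}
    (h : (g : EReal) + ((s : ℝ≥0) : ℝ) = (x : EReal)) : g + s = ENNReal.ofReal x := by
  have h1 : ((g + s : ℝ≥0∞) : EReal) = (x : EReal) := by
    rw [EReal.coe_ennreal_add, ← h]
    rfl
  have h2 : (x : EReal).toENNReal = ENNReal.ofReal x := by
    rw [EReal.toENNReal_of_ne_top (EReal.coe_ne_top x), EReal.toReal_coe]
  rw [← h2, ← h1, EReal.toENNReal_coe]

end SolitonGas

end

/-! ### The main theorem -/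

theorem mainTheorem8
    (Γ : Set ℂ) (hΓ : IsCompact Γ) (hΓpos : ∀ z ∈ Γ, 0 < z.im)
    (ρ : Measure ℂ) (hρ : SolitonGas.IsMeasureOn Γ ρ)
    (σ : ℂ → ℝ≥0) (hσ : ContinuousOn σ Γ)
    (Ω : Set ℂ) (hΩ : IsOpen Ω) (hΩb : Bornology.IsBounded Ω)
    (hcurve : SolitonGas.IsSimpleClosedCurve (frontier Ω)) (hsub : frontier Ω ⊆ Γ)
    (hσ0 : ∀ z ∈ frontier Ω, σ z = 0)
    (φ : ℂ → ℝ) (hφ : ContinuousOn φ (Γ ∪ Ω))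
    (hφΩ : InnerProductSpace.HarmonicOnNhd φ Ω)
    (μ : Measure ℂ)
    (hμ : (∃ u : ℂ → ℝ≥0, SolitonGas.IsSolution Γ ρ σ φ μ u) ∨
      SolitonGas.IsEnergyMinimizer Γ ρ σ φ μ) :
    μ.support ∩ Ω = ∅ := by
  open SolitonGas in
  have hμΓ : IsMeasureOn Γ μ := by
    rcases hμ with ⟨u, hu⟩ | hμ
    exacts [hu.1, hμ.1]
  have := hμΓ.1
  have hcl : closure Ω ⊆ Γ ∪ Ω := by
    rw [closure_eq_interior_union_frontier, hΩ.interior_eq]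
    exact union_subset subset_union_right (hsub.trans subset_union_left)
  have him : closure Ω ⊆ {z | 0 < z.im} :=
    closure_subset_upperHalfPlane hΩ hΩb fun z hz => hΓpos z (hsub hz)
  have hμim : ∀ᵐ z ∂μ, 0 < z.im := hμΓ.ae_mem.mono hΓpos
  have hφΓ : ContinuousOn φ Γ := hφ.mono subset_union_left
  have hlow : ∀ z ∈ Ω, ENNReal.ofReal (φ z) ≤ greenPotential μ z := by
    refine fun z hz => ofReal_le_greenPotential hΩ hΩb him (hφ.mono hcl) hφΩ hμim
      (fun ν hν he => ?_) hz
    rcases hμ with ⟨u, hu⟩ | hμ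
    · refine (ofReal_integral_le_lintegral_ofReal
        ((hν.mono hsub).integrable hΓ hφΓ)).trans (lintegral_mono_ae ?_)
      filter_upwards [hν.ae_mem] with x hx
      rw [← ofReal_eq_of_add_eq_coe (hu.2.2 x (hsub hx)), hσ0 x hx]
      simp
    · exact hμ.ofReal_integral_le hΓ hφΓ (hν.mono hsub) (hν.ae_mem.mono hσ0) he
  have hup : ∀ᵐ z ∂μ, z ∈ Ω → greenPotential μ z ≤ ENNReal.ofReal (φ z) := by
    rcases hμ with ⟨u, hu⟩ | hμ
    · filter_upwards [hμΓ.ae_mem] with z hz _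
      rw [← ofReal_eq_of_add_eq_coe (hu.2.2 z hz)]
      exact le_self_add
    · have := hρ.1
      have hσm : AEMeasurable σ ρ := by
        rw [← Measure.restrict_eq_self_of_ae_mem hρ.ae_mem]
        exact hσ.aemeasurable hΓ.measurableSet
      have hint : Integrable φ (μ.restrict Ω) := (hμΓ.restrict Ω).integrable hΓ hφΓ
      have hle := hμ.setLIntegral_le hΓ hσm hφΓ hΩ.measurableSet
      have hae : (fun z => ENNReal.ofReal (φ z)) ≤ᵐ[μ.restrict Ω] greenPotential μ :=
        (ae_restrict_mem hΩ.measurableSet).mono hlow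
      -- The pointwise lower bound and the integrated upper bound over Ω force equality a.e.; both
      -- sides have finite integral.
      have heq := ae_eq_of_ae_le_of_lintegral_le hae
        (ne_top_of_le_ne_top ENNReal.ofReal_ne_top ((lintegral_mono_ae hae).trans hle))
        (measurable_greenPotential μ).aemeasurable
        (hle.trans (ofReal_integral_le_lintegral_ofReal hint))
      filter_upwards [(ae_restrict_iff' hΩ.measurableSet).1 heq] with z hz hzΩ
      exact (hz hzΩ).ge
  have h0 : μ Ω = 0 :=
    measure_eq_zero_of_greenPotential hΩ (subset_closure.trans him) hφΩ hμim hlow hup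
  rw [← disjoint_iff_inter_eq_empty, disjoint_right]
  exact fun z hz => Measure.notMem_support_iff_exists.2 ⟨Ω, hΩ.mem_nhds hz, h0⟩
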